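/- Let $n\ge 0$ and let $[n]=\{1,\dots,n\}$. For $S\subseteq[n]$ and $h:\{-1,1\}^n\to\mathbb{R}$ put $\hat h(S)=2^{-n}\sum_{x\in\{-1,1\}^n}h(x)\prod_{i\in S}x_i$. Say that $h$ is supported on a family $\mathcal{T}$ of subsets of $[n]$ if $\hat h(S)=0$ for all $S\notin\mathcal{T}$, and that $h$ has degree at most $d$ if $\hat h(S)=0$ whenever $|S|>d$. Let $$\mathcal{T}=\{S\subseteq[n] : |S|\le\lceil n/2\rceil \text{ and } |S|\equiv\lceil n/2\rceil \pmod 2\}.$$ Let $A_\emptyset\in\mathbb{R}$ and $A_{ij}\in\mathbb{R}$ for $1\le i<j\le n$, and suppose that the function $$f(x)=A_\emptyset+\sum_{1\le i<j\le n}A_{ij}x_ix_j$$ is nonnegative on $\{-1,1\}^n$. Then there are functions $h_1,\dots,h_{|\mathcal{T}|}:\{-1,1\}^n\to\mathbb{R}$, each supported on $\mathcal{T}$, such that $$f(x)=\sum_{k=1}^{|\mathcal{T}|}h_k(x)^2\quad\text{for all }x\in\{-1,1\}^n.$$ Consequently, $f$ is a sum of squares of finitely many real functions on $\{-1,1\}^n$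 of degree at most $\lceil n/2\rceil$; in other words, there are finitely many polynomials $p_k\in\mathbb{R}[x_1,\dots,x_n]$ of total degree at most $\lceil n/2\rceil$ with $f(x)=\sum_k p_k(x)^2$ for all $x\in\{-1,1\}^n$ (Laurent's conjecture). -/

import Mathlib

open Finset

/-- The hypercube `{-1,1}^n`, a group under componentwise multiplication. -/
abbrev Cube (n : ℕ) : Type := Fin n → ℤˣ

namespace Cube

/-- The `i`-th coordinate of a vertex of the hypercube, as a real number. -/
def coord {n : ℕ} (x : Cube n) (i : Fin n) : ℝ := ((x i : ℤ) : ℝ)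

/-- The character `χ_S(x) = ∏_{i ∈ S} x_i` of the hypercube. -/
def character {n : ℕ} (S : Finset (Fin n)) (x : Cube n) : ℝ := ∏ i ∈ S, x.coord i

/-- The Fourier coefficient `2⁻ⁿ ∑_x f(x) χ_S(x)`. -/
noncomputable def fourierCoeff {n : ℕ} (f : Cube n → ℝ) (S : Finset (Fin n)) : ℝ :=
  (∑ x : Cube n, f x * character S x) / 2 ^ n

/-- `f` is supported on the family `T` if its Fourier coefficients outside `T` vanish. -/
def SupportedOn {n : ℕ} (f : Cube n → ℝ) (T : Finset (Finset (Fin n))) : Prop :=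
  ∀ S : Finset (Fin n), S ∉ T → fourierCoeff f S = 0

/-- `f` has degree at most `d` if its Fourier coefficients at sets of more than `d` elements
vanish. -/
def HasDegreeLE {n : ℕ} (f : Cube n → ℝ) (d : ℕ) : Prop :=
  ∀ S : Finset (Fin n), d < S.card → fourierCoeff f S = 0

/-- The subsets of `[n]` whose size is at most `⌈n/2⌉` and has the same parity as `⌈n/2⌉`. -/
noncomputable def halfFamily (n : ℕ) : Finset (Finset (Fin n)) :=
  {S : Finset (Fin n) | S.card ≤ ⌈(n : ℝ) / 2⌉₊ ∧ (Even S.card ↔ Even ⌈(n : ℝ) / 2⌉₊)}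

end Cube

/-!
Let `m = ⌈n/2⌉` and let `F` be the family of all `S ⊆ [n]` with `|S| ≡ m` modulo `2`. In the
Euclidean space of functions on the cube put `v_S = √f χ_S`. Then
`⟪v_S, v_U⟫ = ∑ y, f y * χ_{S ∆ U}(y)`, which vanishes as soon as `|S ∆ U| > 2` because `f` is
quadratic. Moreover `f` is even, and the sum of the characters in `F` is concentrated on the two
points `±1`, so `‖∑_{S ∈ F} χ_S(x) v_S‖²` is a positive constant times `f x`
(`Cube.norm_sq_sum_character_smul`).

Two members of `F` of sizes `< m` and `> m` differ in at least four elements, so their vectors are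
orthogonal. Projecting onto the span of the vectors `v_S` with `|S| < m` and onto its orthogonal
complement therefore writes the squared norm as squares of functions supported on the sets of size
`≤ m` plus squares of functions supported on the sets of size `≥ m`
(`exists_norm_sq_sum_smul_eq_add`). The former are supported on `Cube.halfFamily n`. The latter
become so after multiplication by the character of a set `D` with `|D| = 2 (n - m)`, which does not
change their squares: `|S ∆ D| ≤ 2 n - |S| - |D| = 2 m - |S| ≤ m`
(`Cube.exists_symmDiff_card_le`, `Cube.sq_sum_character_eq_translate`).

The number of squares drops to `#(halfFamily n)` by refactoring their common Gram matrix
(`exists_sum_sq_linear_eq_card`).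
-/

/-! ### Sums of squares of linear forms -/

theorem sum_sq_mulVec_eq_dotProduct {μ ν : Type*} [Fintype μ] [Fintype ν] (N : Matrix μ ν ℝ)
    (u : ν → ℝ) : ∑ k, (∑ i, N k i * u i) ^ 2 = u ⬝ᵥ ((N.conjTranspose * N).mulVec u) := by
  rw [← Matrix.mulVec_mulVec, Matrix.dotProduct_mulVec,
    Matrix.conjTranspose_eq_transpose_of_trivial, Matrix.vecMul_transpose]
  simp [dotProduct, Matrix.mulVec, sq]

open scoped MatrixOrder in
/-- A sum of squares of linear forms in the coordinates `t i`, `i ∈ s`, is a sum of only `#s` such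
squares: its Gram matrix `AᵀA` also equals `BᵀB` for a square matrix `B`. -/
theorem exists_sum_sq_linear_eq_card {ι κ : Type*} [Fintype κ] (s : Finset ι) (a : κ → ι → ℝ) :
    ∃ b : Fin s.card → ι → ℝ, ∀ t : ι → ℝ,
      ∑ k, (∑ i ∈ s, a k i * t i) ^ 2 = ∑ k, (∑ i ∈ s, b k i * t i) ^ 2 := by
  classical
  let M : Matrix κ s ℝ := Matrix.of fun k i => a k i
  obtain ⟨B, hB⟩ := CStarAlgebra.nonneg_iff_eq_star_mul_self.mp
    (Matrix.posSemidef_conjTranspose_mul_self M).nonneg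
  refine ⟨fun k => Function.extend Subtype.val (B (s.equivFin.symm k)) 0, fun t => ?_⟩
  have hM := sum_sq_mulVec_eq_dotProduct M fun i => t i
  rw [hB, Matrix.star_eq_conjTranspose, ← sum_sq_mulVec_eq_dotProduct,
    ← s.equivFin.symm.sum_comp] at hM
  simp only [← Finset.sum_coe_sort s, Subtype.val_injective.extend_apply]
  exact hM

/-- The squared norm of a combination of vectors `v i`, in which the vectors indexed by `L` are
orthogonal to those indexed by `R`, splits into squares of linear forms that involve no index of
`R` and squares that involve no index of `L`. -/
theorem exists_norm_sq_sum_smul_eq_add {ι κ : Type*} [Fintype κ] (s : Finset ι)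
    (v : ι → EuclideanSpace ℝ κ) (L R : Set ι)
    (horth : ∀ i ∈ L, ∀ j ∈ R, inner ℝ (v i) (v j) = 0) :
    ∃ a b : κ → ι → ℝ, (∀ k, ∀ i ∈ R, a k i = 0) ∧ (∀ k, ∀ i ∈ L, b k i = 0) ∧
      ∀ t : ι → ℝ, ‖∑ i ∈ s, t i • v i‖ ^ 2 =
        ∑ k, (∑ i ∈ s, a k i * t i) ^ 2 + ∑ k, (∑ i ∈ s, b k i * t i) ^ 2 := by
  -- Project onto the span of the vectors indexed by `L` and onto its orthogonal complement.
  let W : Submodule ℝ (EuclideanSpace ℝ κ) := Submodule.span ℝ (v '' L)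
  refine ⟨fun k i => W.starProjection (v i) k, fun k i => Wᗮ.starProjection (v i) k, ?_, ?_, ?_⟩
  · intro k j hj
    have h : v j ∈ Wᗮ := by
      refine (Submodule.mem_orthogonal _ _).2 fun u hu => ?_
      induction hu using Submodule.span_induction with
      | mem _ h => obtain ⟨i, hi, rfl⟩ := h; exact horth i hi j hj
      | zero => exact inner_zero_left _
      | add _ _ _ _ hx hy => rw [inner_add_left, hx, hy, add_zero]
      | smul _ _ _ hx => rw [inner_smul_left, hx, mul_zero]
    simp [W.starProjection_apply_eq_zero_iff.2 h]
  · intro k i hi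
    have h : v i ∈ Wᗮᗮ := W.le_orthogonal_orthogonal (Submodule.subset_span ⟨i, hi, rfl⟩)
    simp [Wᗮ.starProjection_apply_eq_zero_iff.2 h]
  · intro t
    rw [Submodule.norm_sq_eq_add_norm_sq_starProjection _ W, EuclideanSpace.real_norm_sq_eq,
      EuclideanSpace.real_norm_sq_eq]
    simp [mul_comm]

/-! ### Characters of the hypercube -/

namespace Cube

variable {n : ℕ}

theorem coord_mul (x y : Cube n) (i : Fin n) : (x * y).coord i = x.coord i * y.coord i := by
  simp [coord]

theorem coord_mul_self (x : Cube n) (i : Fin n) : x.coord i * x.coord i = 1 := by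
  rcases Int.units_eq_one_or (x i) with h | h <;> simp [coord, h]

theorem character_mul (S : Finset (Fin n)) (x y : Cube n) :
    character S (x * y) = character S x * character S y := by
  simp [character, coord_mul, Finset.prod_mul_distrib]

theorem character_eq_prod_univ (S : Finset (Fin n)) (x : Cube n) :
    character S x = ∏ i, if i ∈ S then x.coord i else 1 := by
  simp [character, Finset.prod_ite_mem]

theorem character_symmDiff (S T : Finset (Fin n)) (x : Cube n) :
    character (symmDiff S T) x = character S x * character T x := by
  simp only [character_eq_prod_univ, ← Finset.prod_mul_distrib, Finset.mem_symmDiff]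
  refine Finset.prod_congr rfl fun i _ => ?_
  by_cases hS : i ∈ S <;> by_cases hT : i ∈ T <;> simp [hS, hT, coord_mul_self]

theorem character_sq (S : Finset (Fin n)) (x : Cube n) : character S x ^ 2 = 1 := by
  rw [sq, ← character_symmDiff]
  simp [character]

theorem character_pair {i j : Fin n} (hij : i ≠ j) (x : Cube n) :
    character {i, j} x = x.coord i * x.coord j := by
  simp [character, Finset.prod_pair hij]

theorem sum_character_eq_zero {S : Finset (Fin n)} (hS : S.Nonempty) :
    ∑ x : Cube n, character S x = 0 := by
  obtain ⟨i, hi⟩ := hS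
  -- Flipping the `i`-th sign permutes the cube and negates the character.
  have hflip : character S (Pi.mulSingle i (-1) : Cube n) = -1 := by
    rw [character, Finset.prod_eq_single i]
    · simp [coord]
    · intro j _ hj
      simp [coord, hj]
    · exact fun h => absurd hi h
  have h := Equiv.sum_comp (Equiv.mulRight (Pi.mulSingle i (-1) : Cube n)) (character S)
  simp only [Equiv.coe_mulRight, character_mul, hflip, ← Finset.sum_mul] at h
  linarith

theorem sum_character_mul_of_ne {S T : Finset (Fin n)} (h : S ≠ T) :
    ∑ x : Cube n, character S x * character T x = 0 := by
  simp only [← character_symmDiff]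
  refine sum_character_eq_zero (Finset.nonempty_iff_ne_empty.2 fun h0 => h ?_)
  exact symmDiff_eq_bot.1 h0

/-- The Fourier expansion of a quadratic form has no terms beyond degree two. -/
theorem sum_quadratic_mul_character_eq_zero (A₀ : ℝ) (A : Fin n → Fin n → ℝ) {S : Finset (Fin n)}
    (hS : 2 < S.card) :
    ∑ x : Cube n, (A₀ + ∑ i : Fin n, ∑ j ∈ Finset.Ioi i, A i j * x.coord i * x.coord j) *
      character S x = 0 := by
  simp only [add_mul, Finset.sum_add_distrib, Finset.sum_mul]
  rw [← Finset.mul_sum, sum_character_eq_zero (Finset.card_pos.1 (by omega)), mul_zero, zero_add,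
    Finset.sum_comm]
  refine Finset.sum_eq_zero fun i _ => ?_
  rw [Finset.sum_comm]
  refine Finset.sum_eq_zero fun j hj => ?_
  have hij : i ≠ j := (Finset.mem_Ioi.1 hj).ne
  have hne : ({i, j} : Finset (Fin n)) ≠ S := by
    rintro rfl
    rw [Finset.card_pair hij] at hS
    omega
  rw [← mul_zero (A i j), ← sum_character_mul_of_ne hne, Finset.mul_sum]
  simp only [character_pair hij, mul_assoc]

theorem supportedOn_sum_character (T : Finset (Finset (Fin n))) (c : Finset (Fin n) → ℝ) :
    SupportedOn (fun x => ∑ S ∈ T, c S * character S x) T := by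
  intro S hS
  rw [fourierCoeff]
  simp only [Finset.sum_mul]
  rw [Finset.sum_comm, Finset.sum_eq_zero, zero_div]
  intro U hU
  have hne : U ≠ S := by rintro rfl; exact hS hU
  simp only [mul_assoc]
  rw [← Finset.mul_sum, sum_character_mul_of_ne hne, mul_zero]

theorem card_symmDiff_add {α : Type*} [DecidableEq α] (S T : Finset α) :
    (symmDiff S T).card + 2 * (S ∩ T).card = S.card + T.card := by
  have h1 := Finset.card_sdiff_add_card_inter S T
  have h2 := Finset.card_sdiff_add_card_inter T S
  have h3 : (symmDiff S T).card = (S \ T).card + (T \ S).card :=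
    Finset.card_union_of_disjoint disjoint_sdiff_sdiff
  rw [Finset.inter_comm T S] at h2
  omega

/-- The sum over all characters of a fixed degree parity is concentrated on `±1`. -/
theorem sum_character_parity_eq_zero (m : ℕ) {z : Cube n} (h1 : z ≠ 1) (h2 : z ≠ -1) :
    ∑ S : Finset (Fin n) with (Even S.card ↔ Even m), character S z = 0 := by
  obtain ⟨i, hi⟩ := Function.ne_iff.1 h1
  obtain ⟨j, hj⟩ := Function.ne_iff.1 h2
  have hi' : z i = -1 := (Int.units_eq_one_or _).resolve_left hi
  have hj' : z j = 1 := (Int.units_eq_one_or _).resolve_right hj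
  have hij : i ≠ j := by
    rintro rfl
    exact hi hj'
  have hflip : ∀ S : Finset (Fin n), character (symmDiff S {i, j}) z = -character S z := by
    intro S
    rw [character_symmDiff, character_pair hij]
    simp [coord, hi', hj']
  refine Finset.sum_involution (fun S _ => symmDiff S {i, j}) ?_ ?_ ?_ ?_
  · intro S _
    rw [hflip, add_neg_cancel]
  · intro S _ _ h
    have := symmDiff_eq_left.1 h
    simp at this
  · intro S hS
    have hcard := card_symmDiff_add S {i, j}
    rw [Finset.card_pair hij] at hcard
    simp only [Finset.mem_filter, Finset.mem_univ, true_and] at hS ⊢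
    rw [← hS]
    grind
  · intro S _
    exact symmDiff_symmDiff_cancel_right _ _

/-! ### Splitting at the middle level -/

theorem mem_halfFamily {S : Finset (Fin n)} :
    S ∈ halfFamily n ↔ S.card ≤ ⌈(n : ℝ) / 2⌉₊ ∧ (Even S.card ↔ Even ⌈(n : ℝ) / 2⌉₊) := by
  simp [halfFamily]

theorem le_two_mul_ceil_half (n : ℕ) : n ≤ 2 * ⌈(n : ℝ) / 2⌉₊ := by
  have := Nat.le_ceil ((n : ℝ) / 2)
  have : (n : ℝ) ≤ 2 * ⌈(n : ℝ) / 2⌉₊ := by linarith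
  exact_mod_cast this

theorem ceil_half_le (n : ℕ) : ⌈(n : ℝ) / 2⌉₊ ≤ n := by
  refine Nat.ceil_le.2 ?_
  have : (0 : ℝ) ≤ n := n.cast_nonneg
  linarith

/-- Up to a positive constant, an even nonnegative function is recovered as the squared norm of a
combination of the vectors `√f χ_S`, where `|S|` has a fixed parity. -/
theorem norm_sq_sum_character_smul (f : Cube n → ℝ) (hnonneg : ∀ x, 0 ≤ f x)
    (heven : ∀ x, f (-x) = f x) {m : ℕ} (hm : m ≤ n) :
    ∃ c : ℝ, 0 < c ∧ ∀ x : Cube n,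
      ‖∑ S : Finset (Fin n) with (Even S.card ↔ Even m), character S x •
        (WithLp.toLp 2 fun y => √(f y) * character S y : EuclideanSpace ℝ (Cube n))‖ ^ 2 =
      c * f x := by
  let F : Finset (Finset (Fin n)) := {S : Finset (Fin n) | Even S.card ↔ Even m}
  let K : Cube n → ℝ := fun z => ∑ S ∈ F, character S z
  have hF : F.Nonempty := by
    obtain ⟨S, -, hS⟩ := Finset.exists_subset_card_eq (s := (univ : Finset (Fin n))) (n := m)
      (by simpa using hm)
    exact ⟨S, by simp [F, hS]⟩
  have hone : K 1 = F.card := by simp [K, character, coord]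
  have hneg : K (-1) ^ 2 = (F.card : ℝ) ^ 2 := by
    have h : ∀ S ∈ F, character S (-1 : Cube n) = (-1) ^ m := by
      intro S hS
      have hS : Even S.card ↔ Even m := by simpa [F] using hS
      simp only [character, coord, Pi.neg_apply, Pi.one_apply, Units.val_neg, Units.val_one,
        Int.cast_neg, Int.cast_one, Finset.prod_const]
      exact neg_one_pow_congr hS
    simp only [K]
    rw [Finset.sum_congr rfl h, Finset.sum_const, nsmul_eq_mul, mul_pow, ← pow_mul, mul_comm m 2,
      pow_mul]
    norm_num
  have hzero : ∀ z : Cube n, z ≠ 1 → z ≠ -1 → K z = 0 := fun z h1 h2 =>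
    sum_character_parity_eq_zero m h1 h2
  -- When `n = 0`, the vertices `1` and `-1` coincide; the count of `{1, -1}` covers this case.
  refine ⟨({1, -1} : Finset (Cube n)).card * (F.card : ℝ) ^ 2, ?_, fun x => ?_⟩
  · have := hF.card_pos
    have : 0 < ({1, -1} : Finset (Cube n)).card := Finset.card_pos.2 ⟨1, by simp⟩
    positivity
  calc _ = ∑ y, f y * K (x * y) ^ 2 := by
        rw [EuclideanSpace.real_norm_sq_eq]
        refine Finset.sum_congr rfl fun y _ => ?_
        rw [← Real.sq_sqrt (hnonneg y), ← mul_pow, Finset.mul_sum]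
        simp [F, character_mul, mul_left_comm]
    _ = ∑ z, f (x * z) * K z ^ 2 := by
        -- Every vertex is its own inverse.
        have hxx : x * x = 1 := funext fun i => Int.units_mul_self (x i)
        rw [← Equiv.sum_comp (Equiv.mulLeft x)]
        simp [← mul_assoc, hxx]
    _ = ∑ z ∈ ({1, -1} : Finset (Cube n)), f (x * z) * K z ^ 2 := by
        refine (Finset.sum_subset (Finset.subset_univ _) fun z _ hz => ?_).symm
        simp only [Finset.mem_insert, Finset.mem_singleton, not_or] at hz
        simp [hzero z hz.1 hz.2]
    _ = ∑ z ∈ ({1, -1} : Finset (Cube n)), f x * (F.card : ℝ) ^ 2 := by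
        refine Finset.sum_congr rfl fun z hz => ?_
        rcases Finset.mem_insert.1 hz with rfl | hz
        · rw [mul_one, hone]
        · rw [Finset.mem_singleton.1 hz, hneg, mul_neg, mul_one, heven]
    _ = _ := by
        rw [Finset.sum_const, nsmul_eq_mul]
        ring

/-- Translation by a set of `2 * (n - m)` elements folds the upper half of the sets of the parity
of `m` into the lower half. -/
theorem exists_symmDiff_card_le {m : ℕ} (h1 : n ≤ 2 * m) (h2 : m ≤ n) :
    ∃ D : Finset (Fin n), ∀ S : Finset (Fin n), (Even S.card ↔ Even m) →
      (Even (symmDiff S D).card ↔ Even m) ∧ (m ≤ S.card → (symmDiff S D).card ≤ m) := by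
  obtain ⟨D, -, hD⟩ := Finset.exists_subset_card_eq (s := (univ : Finset (Fin n)))
    (n := 2 * (n - m)) (by simp; omega)
  refine ⟨D, fun S hS => ?_⟩
  have hcard := card_symmDiff_add S D
  have hunion := Finset.card_union_add_card_inter S D
  have hle : (S ∪ D).card ≤ n := by simpa using Finset.card_le_univ (S ∪ D)
  refine ⟨?_, fun h => by omega⟩
  rw [← hS]
  grind

/-- Multiplication by the character of `D` translates the support of a combination of
characters by `D`. -/
theorem sq_sum_character_eq_translate (s T : Finset (Finset (Fin n))) (D : Finset (Fin n))
    (c : Finset (Fin n) → ℝ) (h : ∀ S ∈ s, c S ≠ 0 → symmDiff S D ∈ T)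
    (hs : ∀ S ∈ T, symmDiff S D ∈ s) (x : Cube n) :
    (∑ S ∈ s, c S * character S x) ^ 2 =
      (∑ S ∈ T, c (symmDiff S D) * character S x) ^ 2 := by
  have hD : ∑ S ∈ T, c (symmDiff S D) * character S x =
      character D x * ∑ S ∈ s, c S * character S x := by
    rw [Finset.mul_sum]
    refine Finset.sum_bij_ne_zero (fun S _ _ => symmDiff S D) (fun S hS _ => hs S hS)
      (fun S _ _ S' _ _ h => symmDiff_left_injective D h) (fun S hS hne => ?_) (fun S _ _ => ?_)
    · have hc : c S ≠ 0 := fun h0 => hne (by rw [h0, zero_mul, mul_zero])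
      refine ⟨symmDiff S D, h S hS hc, ?_, symmDiff_symmDiff_cancel_right _ _⟩
      rw [symmDiff_symmDiff_cancel_right, character_symmDiff]
      convert hne using 1
      ring
    · rw [character_symmDiff]
      linear_combination (-c (symmDiff S D) * character S x) * character_sq D x
  rw [hD, mul_pow, character_sq, one_mul]

/-- A nonnegative function without Fourier coefficients of degree three or more that is invariant
under negation is a sum of squares of functions supported on `halfFamily n`. -/
theorem exists_sum_sq_halfFamily (f : Cube n → ℝ) (hnonneg : ∀ x, 0 ≤ f x)
    (heven : ∀ x, f (-x) = f x)
    (hdeg : ∀ S : Finset (Fin n), 2 < S.card → ∑ x, f x * character S x = 0) :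
    ∃ b : Fin (halfFamily n).card → Finset (Fin n) → ℝ, ∀ x,
      f x = ∑ k, (∑ S ∈ halfFamily n, b k S * character S x) ^ 2 := by
  set m := ⌈(n : ℝ) / 2⌉₊ with hm
  let F : Finset (Finset (Fin n)) := {S : Finset (Fin n) | Even S.card ↔ Even m}
  have hmem : ∀ {S : Finset (Fin n)}, S ∈ F ↔ (Even S.card ↔ Even m) := by simp [F]
  obtain ⟨c, hc, hfc⟩ := norm_sq_sum_character_smul f hnonneg heven (ceil_half_le n)
  obtain ⟨D, hD⟩ := exists_symmDiff_card_le (le_two_mul_ceil_half n) (ceil_half_le n)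
  have hhalf : ∀ {S : Finset (Fin n)}, S ∈ halfFamily n ↔ S.card ≤ m ∧ S ∈ F := by
    simp [mem_halfFamily, hmem, hm]
  have hsub : halfFamily n ⊆ F := fun S hS => (hhalf.1 hS).2
  -- A set smaller than `m` and one larger than `m`, both of the parity of `m`, differ in at least
  -- four elements, beyond the degree of `f`.
  obtain ⟨p, q, hp, hq, hpq⟩ := exists_norm_sq_sum_smul_eq_add F
    (fun S => WithLp.toLp 2 fun y => √(f y) * character S y)
    {S | S ∈ F ∧ S.card < m} {S | S ∈ F ∧ m < S.card} (by
      rintro S ⟨hS, hSm⟩ U ⟨hU, hUm⟩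
      have hcard : 2 < (symmDiff S U).card := by
        have h1 := card_symmDiff_add S U
        have h2 := Finset.card_le_card (Finset.inter_subset_left (s₁ := S) (s₂ := U))
        rw [hmem] at hS hU
        grind
      rw [← hdeg _ hcard, PiLp.inner_apply]
      refine Finset.sum_congr rfl fun y _ => ?_
      simp only [RCLike.inner_apply, conj_trivial, character_symmDiff]
      linear_combination character S y * character U y * Real.mul_self_sqrt (hnonneg y))
  have hlow : ∀ k x, ∑ S ∈ F, p k S * character S x =
      ∑ S ∈ halfFamily n, p k S * character S x := by
    refine fun k x => (Finset.sum_subset hsub fun S hS hS' => ?_).symm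
    rw [hp k S ⟨hS, not_le.1 fun h => hS' (hhalf.2 ⟨h, hS⟩)⟩, zero_mul]
  have hhigh : ∀ k x, (∑ S ∈ F, q k S * character S x) ^ 2 =
      (∑ S ∈ halfFamily n, q k (symmDiff S D) * character S x) ^ 2 := by
    refine fun k => sq_sum_character_eq_translate F (halfFamily n) D (q k) (fun S hS hne => ?_)
      fun S hS => hmem.2 (hD S (hmem.1 (hsub hS))).1
    have hSm : m ≤ S.card := not_lt.1 fun h => hne (hq k S ⟨hS, h⟩)
    exact hhalf.2 ⟨(hD S (hmem.1 hS)).2 hSm, hmem.2 (hD S (hmem.1 hS)).1⟩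
  obtain ⟨b, hb⟩ := exists_sum_sq_linear_eq_card (halfFamily n)
    (Sum.elim p fun k S => q k (symmDiff S D))
  refine ⟨fun k S => b k S / √c, fun x => ?_⟩
  have hx := hpq fun S => character S x
  simp only [hlow, hhigh] at hx
  have hbx := hb fun S => character S x
  simp only [Fintype.sum_sum_type, Sum.elim_inl, Sum.elim_inr] at hbx
  rw [hbx, hfc] at hx
  simp only [div_mul_eq_mul_div, ← Finset.sum_div, div_pow, Real.sq_sqrt hc.le]
  rw [← hx, mul_div_cancel_left₀ _ hc.ne']

end Cube

theorem theorem2 (n : ℕ) (A₀ : ℝ) (A : Fin n → Fin n → ℝ) (f : Cube n → ℝ)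
    (hf : ∀ x : Cube n,
      f x = A₀ + ∑ i : Fin n, ∑ j ∈ Finset.Ioi i, A i j * x.coord i * x.coord j)
    (hnonneg : ∀ x : Cube n, 0 ≤ f x) :
    (∃ h : Fin (Cube.halfFamily n).card → Cube n → ℝ,
      (∀ k, Cube.SupportedOn (h k) (Cube.halfFamily n)) ∧
      ∀ x : Cube n, f x = ∑ k, h k x ^ 2) ∧
    (∃ (m : ℕ) (g : Fin m → Cube n → ℝ),
      (∀ k, Cube.HasDegreeLE (g k) ⌈(n : ℝ) / 2⌉₊) ∧
      ∀ x : Cube n, f x = ∑ k, g k x ^ 2) ∧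
    (∃ (m : ℕ) (p : Fin m → MvPolynomial (Fin n) ℝ),
      (∀ k, (p k).totalDegree ≤ ⌈(n : ℝ) / 2⌉₊) ∧
      ∀ x : Cube n, f x = ∑ k, (MvPolynomial.eval x.coord (p k)) ^ 2) := by
  have heven : ∀ x, f (-x) = f x := by
    intro x
    simp [hf, Cube.coord]
  obtain ⟨b, hb⟩ := Cube.exists_sum_sq_halfFamily f hnonneg heven fun S hS => by
    simp only [hf]
    exact Cube.sum_quadratic_mul_character_eq_zero A₀ A hS
  have hsupp := fun k => Cube.supportedOn_sum_character (Cube.halfFamily n) (b k)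
  refine ⟨⟨_, hsupp, hb⟩, ⟨_, _, fun k S hS => hsupp k S fun hmem => ?_, hb⟩,
    ⟨_, fun k => ∑ S ∈ Cube.halfFamily n, MvPolynomial.C (b k S) * ∏ i ∈ S, MvPolynomial.X i,
      fun k => ?_, fun x => ?_⟩⟩
  · exact absurd (Cube.mem_halfFamily.1 hmem).1 (not_le.2 hS)
  · refine MvPolynomial.totalDegree_finsetSum_le fun S hS => ?_
    refine le_trans ?_ (Cube.mem_halfFamily.1 hS).1
    refine (MvPolynomial.totalDegree_mul _ _).trans ?_
    rw [MvPolynomial.totalDegree_C, zero_add]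
    refine (MvPolynomial.totalDegree_finsetProd _ _).trans ?_
    simp [MvPolynomial.totalDegree_X]
  · simp [hb, Cube.character, map_sum, map_prod]
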